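/- All Banach spaces are real. For $2<p<\infty$ let $(e_i)_{i\ge1}$ be the unit vector basis of $\ell^p$, and let $J(e_i)$ be the completion of the space of formal finite linear combinations $\sum a_iu_i$ (with $(a_i)$ a finitely non-zero real sequence) under the norm $$\Bigl\|\sum a_iu_i\Bigr\|=\sup\Bigl\{\Bigl\|\sum_{i=1}^{k}\Bigl(\sum_{j=p(i)}^{p(i+1)-1}a_j\Bigr)e_{p(i)}\Bigr\|_p : k\in\mathbb N,\ 1=p(1)<p(2)<\dots<p(k+1)\Bigr\}.$$ A Banach space $E$ has Property (w) if every bounded linear operator from $E$ into its dual $E'$ is weakly compact. A Banach space is weakly sequentially complete if every weakly Cauchy sequence in it converges weakly. Then, for every $2<p<\infty$, the space $J(e_i)$ has Property (w), but its dual $J(e_i)'$ is not weakly sequentially complete. In particular, it is not true that every Banach space with Property (w) has a weakly sequentially complete dual, so the question of E. and P. Saab whether this is the case has a negative answer. -/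

import Mathlib

open scoped ENNReal Topology
open Filter

noncomputable section

/-- A bounded linear operator `T : E → F` is weakly compact if the image of the closed unit
ball of `E` is relatively compact for the weak topology of `F`. -/
def IsWeaklyCompactOperator {E F : Type*} [NormedAddCommGroup E] [NormedSpace ℝ E]
    [NormedAddCommGroup F] [NormedSpace ℝ F] (T : E →L[ℝ] F) : Prop :=
  IsCompact (closure (toWeakSpace ℝ F '' (T '' Metric.closedBall (0 : E) 1)))

/-- Property (w): every bounded linear operator from `E` into its dual is weakly compact. -/
def HasPropertyW (E : Type*) [NormedAddCommGroup E] [NormedSpace ℝ E] : Prop :=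
  ∀ T : E →L[ℝ] StrongDual ℝ E, IsWeaklyCompactOperator T

/-- Every weakly Cauchy sequence is weakly convergent. -/
def IsWeaklySequentiallyComplete (F : Type*) [NormedAddCommGroup F] [NormedSpace ℝ F] : Prop :=
  ∀ x : ℕ → F, (∀ φ : StrongDual ℝ F, CauchySeq fun n => φ (x n)) →
    ∃ y : F, ∀ φ : StrongDual ℝ F, Tendsto (fun n => φ (x n)) atTop (𝓝 (φ y))

section JamesType

variable {E : Type*} [NormedAddCommGroup E] [NormedSpace ℝ E]

/-- Strictly increasing sequences `0 = p 0 < p 1 < p 2 < ⋯` of indices. Only finite initial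
pieces `p 0 < ⋯ < p k` of them are used, and every such finite sequence extends to one of these. -/
abbrev JamesBlockSeq : Type := {p : ℕ → ℕ // StrictMono p ∧ p 0 = 0}

/-- The representative `∑_{i < k} (∑_{p i ≤ j < p (i + 1)} a j) • e (p i)`
of the finitely supported sequence `a` (indices start at `0`). -/
def jamesRepresentative (e : ℕ → E) (k : ℕ) (p : JamesBlockSeq) (a : ℕ →₀ ℝ) : E :=
  ∑ i ∈ Finset.range k, (∑ j ∈ Finset.Ico (p.1 i) (p.1 (i + 1)), a j) • e (p.1 i)

/-- The James type norm of a finitely supported sequence `a = ∑ a i u i`: the supremum of the norms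
of its representatives. -/
def jamesNorm (e : ℕ → E) (a : ℕ →₀ ℝ) : ℝ :=
  ⨆ x : ℕ × JamesBlockSeq, ‖jamesRepresentative e x.1 x.2 a‖

theorem sum_jamesBlocks (p : JamesBlockSeq) (f : ℕ → ℝ) (k : ℕ) :
    ∑ i ∈ Finset.range k, ∑ j ∈ Finset.Ico (p.1 i) (p.1 (i + 1)), f j =
      ∑ j ∈ Finset.range (p.1 k), f j := by
  induction k with
  | zero => simp [p.2.2]
  | succ k ih =>
    rw [Finset.sum_range_succ, ih]
    exact Finset.sum_range_add_sum_Ico f (p.2.1.monotone (Nat.le_succ k))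

theorem norm_jamesRepresentative_le (e : ℕ → E) (k : ℕ) (p : JamesBlockSeq) (a : ℕ →₀ ℝ) :
    ‖jamesRepresentative e k p a‖ ≤
      ∑ j ∈ a.support, |a j| * ∑ m ∈ Finset.range (j + 1), ‖e m‖ := by
  calc ‖jamesRepresentative e k p a‖
      ≤ ∑ i ∈ Finset.range k, ∑ j ∈ Finset.Ico (p.1 i) (p.1 (i + 1)),
          |a j| * ∑ m ∈ Finset.range (j + 1), ‖e m‖ := by
        refine (norm_sum_le _ _).trans (Finset.sum_le_sum fun i _ => ?_)
        rw [norm_smul, Real.norm_eq_abs]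
        refine (mul_le_mul_of_nonneg_right (Finset.abs_sum_le_sum_abs _ _)
          (norm_nonneg _)).trans ?_
        rw [Finset.sum_mul]
        refine Finset.sum_le_sum fun j hj => mul_le_mul_of_nonneg_left ?_ (abs_nonneg _)
        refine Finset.single_le_sum (f := fun m => ‖e m‖) (fun m _ => norm_nonneg _) ?_
        have := (Finset.mem_Ico.1 hj).1
        exact Finset.mem_range.2 (by omega)
    _ = ∑ j ∈ Finset.range (p.1 k), |a j| * ∑ m ∈ Finset.range (j + 1), ‖e m‖ :=
        sum_jamesBlocks p _ k
    _ ≤ ∑ j ∈ a.support, |a j| * ∑ m ∈ Finset.range (j + 1), ‖e m‖ := by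
        have h0 : ∀ j, 0 ≤ |a j| * ∑ m ∈ Finset.range (j + 1), ‖e m‖ := fun j =>
          mul_nonneg (abs_nonneg _) (Finset.sum_nonneg fun m _ => norm_nonneg _)
        rw [← Finset.sum_filter_add_sum_filter_not (Finset.range (p.1 k)) (fun j => a j ≠ 0),
          Finset.sum_eq_zero (s := (Finset.range (p.1 k)).filter fun j => ¬ a j ≠ 0), add_zero]
        · refine Finset.sum_le_sum_of_subset_of_nonneg (fun j hj => ?_) fun j _ _ => h0 j
          exact Finsupp.mem_support_iff.2 (Finset.mem_filter.1 hj).2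
        · intro j hj
          have := (Finset.mem_filter.1 hj).2
          simp only [ne_eq, not_not] at this
          simp [this]

theorem bddAbove_jamesRepresentative (e : ℕ → E) (a : ℕ →₀ ℝ) :
    BddAbove (Set.range fun x : ℕ × JamesBlockSeq => ‖jamesRepresentative e x.1 x.2 a‖) :=
  ⟨_, by rintro _ ⟨x, rfl⟩; exact norm_jamesRepresentative_le e x.1 x.2 a⟩

theorem jamesRepresentative_add (e : ℕ → E) (k : ℕ) (p : JamesBlockSeq) (a b : ℕ →₀ ℝ) :
    jamesRepresentative e k p (a + b) =
      jamesRepresentative e k p a + jamesRepresentative e k p b := by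
  simp [jamesRepresentative, Finset.sum_add_distrib, add_smul]

theorem jamesRepresentative_smul (e : ℕ → E) (k : ℕ) (p : JamesBlockSeq) (c : ℝ) (a : ℕ →₀ ℝ) :
    jamesRepresentative e k p (c • a) = c • jamesRepresentative e k p a := by
  simp [jamesRepresentative, Finset.smul_sum, ← Finset.mul_sum, mul_smul]

instance : Nonempty JamesBlockSeq := ⟨⟨id, strictMono_id, rfl⟩⟩

theorem jamesNorm_nonneg (e : ℕ → E) (a : ℕ →₀ ℝ) : 0 ≤ jamesNorm e a :=
  Real.iSup_nonneg fun _ => norm_nonneg _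

theorem jamesNorm_smul (e : ℕ → E) (c : ℝ) (a : ℕ →₀ ℝ) :
    jamesNorm e (c • a) = ‖c‖ * jamesNorm e a := by
  simp only [jamesNorm, jamesRepresentative_smul, norm_smul]
  exact (Real.mul_iSup_of_nonneg (norm_nonneg c) _).symm

theorem jamesNorm_add_le (e : ℕ → E) (a b : ℕ →₀ ℝ) :
    jamesNorm e (a + b) ≤ jamesNorm e a + jamesNorm e b := by
  refine ciSup_le fun x => ?_
  rw [jamesRepresentative_add]
  exact (norm_add_le _ _).trans (add_le_add
    (le_ciSup (bddAbove_jamesRepresentative e a) x)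
    (le_ciSup (bddAbove_jamesRepresentative e b) x))

/-- The space `c₀₀` of finitely supported real sequences, to be normed by `jamesNorm e`. -/
def JamesC00 (_e : ℕ → E) : Type := ℕ →₀ ℝ

instance (e : ℕ → E) : AddCommGroup (JamesC00 e) := inferInstanceAs (AddCommGroup (ℕ →₀ ℝ))

instance (e : ℕ → E) : Module ℝ (JamesC00 e) := inferInstanceAs (Module ℝ (ℕ →₀ ℝ))

/-- The identity map, forgetting the norm. -/
def JamesC00.toFinsupp (e : ℕ → E) : JamesC00 e ≃ₗ[ℝ] (ℕ →₀ ℝ) := LinearEquiv.refl ℝ (ℕ →₀ ℝ)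

instance (e : ℕ → E) : Norm (JamesC00 e) := ⟨fun a => jamesNorm e (JamesC00.toFinsupp e a)⟩

theorem JamesC00.norm_def (e : ℕ → E) (a : JamesC00 e) :
    ‖a‖ = jamesNorm e (JamesC00.toFinsupp e a) := rfl

theorem jamesC00_core (e : ℕ → E) : SeminormedSpace.Core ℝ (JamesC00 e) where
  norm_nonneg a := jamesNorm_nonneg e _
  norm_smul c a := by
    rw [JamesC00.norm_def, JamesC00.norm_def, map_smul, jamesNorm_smul]
  norm_triangle a b := by
    rw [JamesC00.norm_def, JamesC00.norm_def, JamesC00.norm_def, map_add]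
    exact jamesNorm_add_le e _ _

instance (e : ℕ → E) : SeminormedAddCommGroup (JamesC00 e) :=
  SeminormedAddCommGroup.ofCore (jamesC00_core e)

instance (e : ℕ → E) : NormedSpace ℝ (JamesC00 e) where
  norm_smul_le c a := ((jamesC00_core e).norm_smul c a).le

/-- The James type space `J(e_i)`: the completion of `c₀₀` in the norm `jamesNorm e`. -/
abbrev JamesSpace (e : ℕ → E) : Type := UniformSpace.Completion (JamesC00 e)

end JamesType

/-- The unit vector basis of the real sequence space `ℓ^p`. -/
def lpUnitBasis (p : ℝ≥0∞) [Fact (1 ≤ p)] (i : ℕ) : lp (fun _ : ℕ => ℝ) p :=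
  lp.single p i (1 : ℝ)

end

/-! Writing s(n) for the sum of the first n coefficients of a, the p-th power of ‖a‖ is the supremum
of ∑ |s(t(i+1)) - s(t(i))|^p over increasing chains t: the norm is the p-variation of the partial
sums. Call a vector a bump if its partial sums vanish off a finite interval.

Disjoint bumps satisfy an upper p-estimate (`norm_sum_rpow_le_of_disjoint`). If a bounded bilinear
form B had size at least ε on bounded pairs of bumps arbitrarily far out, suitable signs would give
mε ≤ const · m^(2/p) for all m, which is absurd for p > 2 (`not_forall_exists_bumps`). Hence the
unit vectors u(n), whose differences are bumps, are weakly Cauchy; let F be their limit in the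
bidual. Truncation satisfies a lower p-estimate (`norm_rpow_add_norm_rpow_le`), and together these
facts make the bidual the space plus the line through F (`exists_bidual_eq`).

For T from the space to its dual, weak compactness then reduces to F(F∘T) = F(F∘T.flip), the
equality of the two iterated limits of T(u(a))(u(b)). It holds because second differences of this
double sequence are values of the form on pairs of bumps (`iterated_limits_eq`).

The partial sum functionals are weakly Cauchy in the dual, and their only possible weak limit is the
total sum functional. But F is 0 on each of them and 1 on the total sum. -/

noncomputable section

/-! ### Partial sums on c₀₀ -/

section PartialSums

variable {E : Type*}

/-- The partial sum functional `a ↦ ∑_{j < n} a j`. -/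
def jamesPartialSum (e : ℕ → E) (n : ℕ) : JamesC00 e →ₗ[ℝ] ℝ :=
  ∑ j ∈ Finset.range n, Finsupp.lapply j ∘ₗ (JamesC00.toFinsupp e).toLinearMap

/-- The unit vector `u n` of `c₀₀`. -/
def jamesUnit (e : ℕ → E) (n : ℕ) : JamesC00 e :=
  (JamesC00.toFinsupp e).symm (Finsupp.single n 1)

theorem jamesPartialSum_apply (e : ℕ → E) (n : ℕ) (a : JamesC00 e) :
    jamesPartialSum e n a = ∑ j ∈ Finset.range n, JamesC00.toFinsupp e a j := by
  simp [jamesPartialSum]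

@[simp]
theorem jamesPartialSum_zero (e : ℕ → E) (a : JamesC00 e) : jamesPartialSum e 0 a = 0 := by
  simp [jamesPartialSum_apply]

theorem jamesPartialSum_unit (e : ℕ → E) (n m : ℕ) :
    jamesPartialSum e n (jamesUnit e m) = if m < n then 1 else 0 := by
  simp [jamesPartialSum_apply, jamesUnit, Finsupp.single_apply]

theorem jamesPartialSum_sum_smul_unit (e : ℕ → E) (c : ℕ → ℝ) (N n : ℕ) :
    jamesPartialSum e n (∑ j ∈ Finset.range N, c j • jamesUnit e j) =
      ∑ j ∈ Finset.range (min n N), c j := by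
  simp only [map_sum, map_smul, jamesPartialSum_unit, smul_eq_mul, mul_ite, mul_one, mul_zero]
  rw [← Finset.sum_filter]
  congr 1
  ext j
  simp [and_comm]

theorem jamesC00_eq_sum_unit (e : ℕ → E) (a : JamesC00 e) :
    ∃ N, ∀ M, N ≤ M →
      a = ∑ j ∈ Finset.range M, JamesC00.toFinsupp e a j • jamesUnit e j := by
  obtain ⟨N, hN⟩ := (JamesC00.toFinsupp e a).support.exists_nat_subset_range
  refine ⟨N, fun M hM => (JamesC00.toFinsupp e).injective ?_⟩
  rw [map_sum]
  ext i
  simp only [map_smul, jamesUnit, LinearEquiv.apply_symm_apply, Finsupp.coe_finsetSum,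
    Finset.sum_apply, Finsupp.smul_apply, Finsupp.single_apply, smul_eq_mul, mul_ite, mul_one,
    mul_zero, Finset.sum_ite_eq', Finset.mem_range]
  split_ifs with h
  · rfl
  · by_contra h0
    have := Finset.mem_range.1 (hN (Finsupp.mem_support_iff.2 h0))
    omega

theorem sum_Ico_toFinsupp (e : ℕ → E) (a : JamesC00 e) {m n : ℕ} (h : m ≤ n) :
    ∑ j ∈ Finset.Ico m n, JamesC00.toFinsupp e a j =
      jamesPartialSum e n a - jamesPartialSum e m a := by
  rw [jamesPartialSum_apply, jamesPartialSum_apply, Finset.sum_Ico_eq_sub _ h]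

end PartialSums

/-! ### The norm as p-variation, with its lower and upper p-estimates -/

section LpChains

variable {p : ℝ≥0∞} [Fact (1 ≤ p)]

theorem norm_jamesRepresentative_lp (h0 : 0 < p.toReal) (k : ℕ) (q : JamesBlockSeq)
    (a : JamesC00 (lpUnitBasis p)) :
    ‖jamesRepresentative (lpUnitBasis p) k q (JamesC00.toFinsupp _ a)‖ ^ p.toReal =
      ∑ i ∈ Finset.range k, |jamesPartialSum _ (q.1 (i + 1)) a - jamesPartialSum _ (q.1 i) a|
        ^ p.toReal := by
  classical
  have hinj : Function.Injective q.1 := q.2.1.injective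
  -- The block starts are distinct, so the increments can be indexed by their positions in ℓ^p.
  let g : ℕ → ℝ := Function.extend q.1
    (fun i => jamesPartialSum _ (q.1 (i + 1)) a - jamesPartialSum _ (q.1 i) a) 0
  have hg : ∀ i, g (q.1 i) = jamesPartialSum _ (q.1 (i + 1)) a - jamesPartialSum _ (q.1 i) a :=
    fun i => hinj.extend_apply _ _ i
  have h1 : jamesRepresentative (lpUnitBasis p) k q (JamesC00.toFinsupp _ a) =
      ∑ n ∈ (Finset.range k).image q.1, lp.single p n (g n) := by
    rw [Finset.sum_image hinj.injOn]
    refine Finset.sum_congr rfl fun i _ => ?_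
    rw [sum_Ico_toFinsupp _ _ (q.2.1.monotone (Nat.le_succ i)), hg, lpUnitBasis,
      ← lp.single_smul]
    simp
  rw [h1, lp.norm_sum_single h0 (E := fun _ : ℕ => ℝ) g, Finset.sum_image hinj.injOn]
  simp [hg]

/-- Repeated values of t contribute 0^r = 0 and are skipped; if t starts above 0, a first block from
0 only adds a nonnegative term. This frees later arguments from strictness and from the starting
point. Values of q beyond l are filler. -/
theorem exists_blockSeq_sum_ge {r : ℝ} (h0 : 0 < r) (s : ℕ → ℝ) {t : ℕ → ℕ} (ht : Monotone t)
    (k : ℕ) :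
    ∃ (l : ℕ) (q : JamesBlockSeq), q.1 l = t k ∧
      ∑ i ∈ Finset.range k, |s (t (i + 1)) - s (t i)| ^ r ≤
        ∑ i ∈ Finset.range l, |s (q.1 (i + 1)) - s (q.1 i)| ^ r := by
  induction k with
  | zero =>
    rcases Nat.eq_zero_or_pos (t 0) with h | h
    · exact ⟨0, ⟨id, strictMono_id, rfl⟩, h.symm, by simp⟩
    · refine ⟨1, ⟨fun i => if i = 0 then 0 else t 0 + (i - 1), ?_, rfl⟩, by simp, ?_⟩
      · refine strictMono_nat_of_lt_succ fun i => ?_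
        rcases i with _ | i
        · simpa using h
        · simp
      · simp only [Finset.range_zero, Finset.sum_empty]
        positivity
  | succ k ih =>
    obtain ⟨l, q, hq, hle⟩ := ih
    rcases (ht (Nat.le_succ k)).eq_or_lt with h | h
    · refine ⟨l, q, hq.trans h, ?_⟩
      rw [Finset.sum_range_succ, ← Nat.succ_eq_add_one, ← h]
      simpa [Real.zero_rpow h0.ne'] using hle
    · have hq' : ∀ i, i ≤ l → (if i ≤ l then q.1 i else t (k + 1) + (i - l - 1)) = q.1 i :=
        fun i hi => if_pos hi
      refine ⟨l + 1, ⟨fun i => if i ≤ l then q.1 i else t (k + 1) + (i - l - 1), ?_, ?_⟩, ?_, ?_⟩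
      · refine strictMono_nat_of_lt_succ fun i => ?_
        rcases lt_trichotomy i l with hi | hi | hi
        · simpa [hi.le, Nat.succ_le_of_lt hi] using q.2.1 (Nat.lt_succ_self i)
        · subst hi
          simpa [hq] using h
        · rw [if_neg (by omega), if_neg (by omega)]
          omega
      · simpa using q.2.2
      · simp
      · rw [Finset.sum_range_succ, Finset.sum_range_succ]
        refine add_le_add (hle.trans_eq (Finset.sum_congr rfl fun i hi => ?_)) ?_
        · have := Finset.mem_range.1 hi
          simp only [this.le, Nat.succ_le_of_lt this, if_true]
        · simp [hq]

theorem sum_chain_le_norm_rpow (h0 : 0 < p.toReal) (a : JamesC00 (lpUnitBasis p)) {t : ℕ → ℕ}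
    (ht : Monotone t) (k : ℕ) :
    ∑ i ∈ Finset.range k, |jamesPartialSum _ (t (i + 1)) a - jamesPartialSum _ (t i) a| ^ p.toReal ≤
      ‖a‖ ^ p.toReal := by
  obtain ⟨l, q, -, hle⟩ := exists_blockSeq_sum_ge h0 (fun n => jamesPartialSum _ n a) ht k
  refine hle.trans ?_
  rw [← norm_jamesRepresentative_lp h0]
  exact Real.rpow_le_rpow (norm_nonneg _)
    (le_ciSup (bddAbove_jamesRepresentative (lpUnitBasis p) _) (l, q)) h0.le

theorem norm_rpow_le_of_chains (h0 : 0 < p.toReal) (a : JamesC00 (lpUnitBasis p)) {D : ℝ}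
    (h : ∀ (k : ℕ) (t : ℕ → ℕ), Monotone t → ∑ i ∈ Finset.range k,
      |jamesPartialSum _ (t (i + 1)) a - jamesPartialSum _ (t i) a| ^ p.toReal ≤ D) :
    ‖a‖ ^ p.toReal ≤ D := by
  have hD : 0 ≤ D := by simpa using h 0 id monotone_id
  rw [← Real.le_rpow_inv_iff_of_pos (norm_nonneg _) hD h0]
  refine ciSup_le fun x => ?_
  rw [Real.le_rpow_inv_iff_of_pos (norm_nonneg _) hD h0, norm_jamesRepresentative_lp h0]
  exact h _ _ x.2.2.1.monotone

theorem abs_jamesPartialSum_sub_le (h0 : 0 < p.toReal) (a : JamesC00 (lpUnitBasis p)) {m n : ℕ}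
    (h : m ≤ n) : |jamesPartialSum _ n a - jamesPartialSum _ m a| ≤ ‖a‖ := by
  have := sum_chain_le_norm_rpow h0 a (t := fun i => if i = 0 then m else n)
    (monotone_nat_of_le_succ fun i => by rcases i with _ | i <;> simp [h]) 1
  simp only [Finset.sum_range_one, if_true, zero_add, one_ne_zero, if_false] at this
  exact (Real.rpow_le_rpow_iff (abs_nonneg _) (norm_nonneg _) h0).1 this

theorem abs_jamesPartialSum_le (h0 : 0 < p.toReal) (a : JamesC00 (lpUnitBasis p)) (n : ℕ) :
    |jamesPartialSum _ n a| ≤ ‖a‖ := by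
  simpa using abs_jamesPartialSum_sub_le h0 a (Nat.zero_le n)

/-- Lower p-estimate: a chain for the head b, capped at N, followed by a chain for the tail c,
pushed above N, is a chain for a. -/
theorem norm_rpow_add_norm_rpow_le (h0 : 0 < p.toReal) {a b c : JamesC00 (lpUnitBasis p)} (N : ℕ)
    (hb : ∀ n, jamesPartialSum _ n b = jamesPartialSum _ (min n N) a)
    (hc : ∀ n, jamesPartialSum _ n c = jamesPartialSum _ (max n N) a - jamesPartialSum _ N a) :
    ‖b‖ ^ p.toReal + ‖c‖ ^ p.toReal ≤ ‖a‖ ^ p.toReal := by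
  rw [← le_sub_iff_add_le]
  refine norm_rpow_le_of_chains h0 b fun k t ht => ?_
  rw [le_sub_comm]
  refine norm_rpow_le_of_chains h0 c fun k' t' ht' => ?_
  rw [le_sub_iff_add_le, add_comm]
  -- The head chain uses indices 0 to k, so the tail chain starts at k + 1; the joining increment is
  -- nonnegative and is dropped.
  let q : ℕ → ℕ := fun i => if i ≤ k then min (t i) N else max (t' (i - (k + 1))) N
  have hq : Monotone q := by
    refine monotone_nat_of_le_succ fun i => ?_
    simp only [q]
    rcases lt_trichotomy i k with hi | hi | hi
    · rw [if_pos hi.le, if_pos (by omega)]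
      exact min_le_min_right _ (ht (Nat.le_succ i))
    · rw [if_pos hi.le, if_neg (by omega)]
      exact (min_le_right _ _).trans (le_max_right _ _)
    · rw [if_neg (by omega), if_neg (by omega)]
      exact max_le_max_right _ (ht' (by omega))
  refine le_trans ?_ (sum_chain_le_norm_rpow h0 a hq (k + 1 + k'))
  rw [Finset.sum_range_add, Finset.sum_range_succ, add_assoc]
  refine add_le_add (Finset.sum_le_sum fun i hi => ?_) ?_
  · have := Finset.mem_range.1 hi
    simp only [q, hb]
    rw [if_pos this.le, if_pos (by omega)]
  · refine le_add_of_nonneg_of_le (by positivity) (Finset.sum_le_sum fun i hi => ?_)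
    simp only [q, hc]
    rw [if_neg (by omega), if_neg (by omega), show k + 1 + i + 1 - (k + 1) = i + 1 by omega,
      show k + 1 + i - (k + 1) = i by omega]
    simp

/-- At most one f i and one g i are nonzero, so at most two differences survive, each bounded by the
ℓ^r norm of them all. -/
theorem abs_sum_rpow_le_of_disjoint {ι : Type*} {r : ℝ} (h0 : 0 < r) (s : Finset ι) (f g : ι → ℝ)
    (hf : ∀ i ∈ s, ∀ j ∈ s, f i ≠ 0 → f j ≠ 0 → i = j)
    (hg : ∀ i ∈ s, ∀ j ∈ s, g i ≠ 0 → g j ≠ 0 → i = j) :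
    |∑ i ∈ s, (f i - g i)| ^ r ≤ 2 ^ r * ∑ i ∈ s, |f i - g i| ^ r := by
  classical
  have hsingle : ∀ h : ι → ℝ, (∀ i ∈ s, ∀ j ∈ s, h i ≠ 0 → h j ≠ 0 → i = j) →
      (s.filter fun i => h i ≠ 0).card ≤ 1 := fun h hh =>
    Finset.card_le_one.2 fun i hi j hj => by
      rw [Finset.mem_filter] at hi hj
      exact hh i hi.1 j hj.1 hi.2 hj.2
  set t := (s.filter fun i => f i ≠ 0) ∪ s.filter fun i => g i ≠ 0
  have hts : t ⊆ s := Finset.union_subset (Finset.filter_subset _ _) (Finset.filter_subset _ _)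
  have ht : (t.card : ℝ) ≤ 2 := by
    exact_mod_cast (Finset.card_union_le _ _).trans (add_le_add (hsingle f hf) (hsingle g hg))
  have hsum : ∑ i ∈ s, (f i - g i) = ∑ i ∈ t, (f i - g i) := by
    refine (Finset.sum_subset hts fun i hi hit => ?_).symm
    simp only [t, Finset.mem_union, Finset.mem_filter, not_or, not_and, not_not] at hit
    rw [hit.1 hi, hit.2 hi, sub_zero]
  set D := ∑ i ∈ s, |f i - g i| ^ r
  have hD : 0 ≤ D := by positivity
  have hle : ∀ i ∈ t, |f i - g i| ≤ D ^ r⁻¹ := fun i hi => by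
    rw [Real.le_rpow_inv_iff_of_pos (abs_nonneg _) hD h0]
    exact Finset.single_le_sum (f := fun i => |f i - g i| ^ r) (fun _ _ => by positivity) (hts hi)
  have h1 : |∑ i ∈ s, (f i - g i)| ≤ 2 * D ^ r⁻¹ := by
    rw [hsum]
    refine (Finset.abs_sum_le_sum_abs _ _).trans ((Finset.sum_le_card_nsmul _ _ _ hle).trans ?_)
    rw [nsmul_eq_mul]
    exact mul_le_mul_of_nonneg_right ht (by positivity)
  refine (Real.rpow_le_rpow (abs_nonneg _) h1 h0.le).trans_eq ?_
  rw [Real.mul_rpow (by norm_num) (by positivity), Real.rpow_inv_rpow hD h0.ne']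

/-- Upper p-estimate: each increment of a chain meets at most one summand at either endpoint, so the
preceding bound applies increment by increment. -/
theorem norm_sum_rpow_le_of_disjoint {ι : Type*} (h0 : 0 < p.toReal) (s : Finset ι)
    (y : ι → JamesC00 (lpUnitBasis p))
    (hy : ∀ n, ∀ i ∈ s, ∀ j ∈ s, jamesPartialSum _ n (y i) ≠ 0 → jamesPartialSum _ n (y j) ≠ 0 →
      i = j) :
    ‖∑ i ∈ s, y i‖ ^ p.toReal ≤ 2 ^ p.toReal * ∑ i ∈ s, ‖y i‖ ^ p.toReal := by
  refine norm_rpow_le_of_chains h0 _ fun k t ht => ?_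
  calc _ ≤ ∑ l ∈ Finset.range k, 2 ^ p.toReal * ∑ i ∈ s,
        |jamesPartialSum _ (t (l + 1)) (y i) - jamesPartialSum _ (t l) (y i)| ^ p.toReal := by
        refine Finset.sum_le_sum fun l _ => ?_
        rw [map_sum, map_sum, ← Finset.sum_sub_distrib]
        exact abs_sum_rpow_le_of_disjoint h0 s _ _ (hy _) (hy _)
    _ ≤ _ := by
        rw [← Finset.mul_sum, Finset.sum_comm]
        gcongr
        exact sum_chain_le_norm_rpow h0 _ ht k

theorem norm_jamesUnit_le (h0 : 0 < p.toReal) (n : ℕ) : ‖jamesUnit (lpUnitBasis p) n‖ ≤ 1 := by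
  have h : ‖jamesUnit (lpUnitBasis p) n‖ ^ p.toReal ≤ 1 := by
    refine norm_rpow_le_of_chains h0 _ fun k t ht => ?_
    -- The partial sums form a single step from 0 to 1, so each increment is 0 or 1, equals its own
    -- power, and the sum telescopes.
    calc _ = ∑ i ∈ Finset.range k, (jamesPartialSum _ (t (i + 1)) (jamesUnit (lpUnitBasis p) n) -
          jamesPartialSum _ (t i) (jamesUnit (lpUnitBasis p) n)) := by
          refine Finset.sum_congr rfl fun i _ => ?_
          have : t i ≤ t (i + 1) := ht (Nat.le_succ i)
          simp only [jamesPartialSum_unit]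
          split_ifs <;> first | omega | simp [Real.zero_rpow h0.ne']
      _ ≤ 1 := by
          rw [Finset.sum_range_sub fun i => jamesPartialSum _ (t i) (jamesUnit (lpUnitBasis p) n)]
          simp only [jamesPartialSum_unit]
          split_ifs <;> norm_num
  rw [← Real.one_rpow p.toReal] at h
  exact (Real.rpow_le_rpow_iff (norm_nonneg _) zero_le_one h0).1 h

end LpChains

/-- The diagonal terms do not see the signs, since each sign squares to 1; choosing the signs one at
a time keeps every new cross term nonnegative. -/
theorem exists_signs_sum_le {W : Type*} [NormedAddCommGroup W] [NormedSpace ℝ W]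
    (B : W →L[ℝ] StrongDual ℝ W) (x y : ℕ → W) (m : ℕ) :
    ∃ c : ℕ → ℝ, (∀ i, |c i| = 1) ∧ ∑ i ∈ Finset.range m, B (x i) (y i) ≤
      B (∑ i ∈ Finset.range m, c i • x i) (∑ i ∈ Finset.range m, c i • y i) := by
  induction m with
  | zero => exact ⟨fun _ => 1, by simp, by simp⟩
  | succ m ih =>
    obtain ⟨c, hc, hle⟩ := ih
    set X := ∑ i ∈ Finset.range m, c i • x i with hX
    set Y := ∑ i ∈ Finset.range m, c i • y i with hY
    obtain ⟨d, hd, hd0⟩ : ∃ d : ℝ, |d| = 1 ∧ 0 ≤ d * (B X (y m) + B (x m) Y) := by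
      rcases le_total 0 (B X (y m) + B (x m) Y) with h | h
      · exact ⟨1, by simp, by simpa using h⟩
      · exact ⟨-1, by simp, by linarith⟩
    have hdd : d * d = 1 := by rw [← abs_mul_abs_self, hd, one_mul]
    have hup : ∀ z : ℕ → W, ∑ i ∈ Finset.range (m + 1), Function.update c m d i • z i =
        ∑ i ∈ Finset.range m, c i • z i + d • z m := fun z => by
      rw [Finset.sum_range_succ, Function.update_self]
      congr 1
      refine Finset.sum_congr rfl fun i hi => ?_
      rw [Function.update_of_ne (Finset.mem_range.1 hi).ne]
    refine ⟨Function.update c m d, fun i => ?_, ?_⟩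
    · rcases eq_or_ne i m with rfl | h
      · simpa using hd
      · simpa [h] using hc i
    · rw [hup, hup, ← hX, ← hY, Finset.sum_range_succ]
      simp only [map_add, map_smul, add_apply, smul_apply,
        smul_eq_mul]
      have : d * (d * B (x m) (y m)) = B (x m) (y m) := by rw [← mul_assoc, hdd, one_mul]
      linarith

/-! ### Bilinear forms and functionals on bumps -/

section Bumps

variable {p : ℝ≥0∞} [Fact (1 ≤ p)]

/-- The embedding of `c₀₀` into the James type space. -/
def jamesEmb (p : ℝ≥0∞) [Fact (1 ≤ p)] :
    JamesC00 (lpUnitBasis p) →L[ℝ] JamesSpace (lpUnitBasis p) :=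
  UniformSpace.Completion.toComplL

theorem norm_jamesEmb (x : JamesC00 (lpUnitBasis p)) : ‖jamesEmb p x‖ = ‖x‖ :=
  UniformSpace.Completion.norm_coe x

theorem norm_sum_le_of_disjoint (h0 : 0 < p.toReal) {C : ℝ} (hC : 0 ≤ C) (m : ℕ)
    {y : ℕ → JamesC00 (lpUnitBasis p)} (hyC : ∀ i, ‖y i‖ ≤ C)
    (hy : ∀ n i j, jamesPartialSum _ n (y i) ≠ 0 → jamesPartialSum _ n (y j) ≠ 0 → i = j)
    {c : ℕ → ℝ} (hc : ∀ i, |c i| = 1) :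
    ‖∑ i ∈ Finset.range m, c i • y i‖ ≤ 2 * C * (m : ℝ) ^ p.toReal⁻¹ := by
  rw [← Real.rpow_le_rpow_iff (norm_nonneg _) (by positivity) h0,
    Real.mul_rpow (by positivity) (by positivity), Real.rpow_inv_rpow (by positivity) h0.ne',
    Real.mul_rpow (by norm_num) hC]
  refine (norm_sum_rpow_le_of_disjoint h0 _ _ fun n i _ j _ hi hj => hy n i j ?_ ?_).trans ?_
  · intro h
    simp [h] at hi
  · intro h
    simp [h] at hj
  · rw [mul_assoc]
    refine mul_le_mul_of_nonneg_left ?_ (by positivity)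
    refine (Finset.sum_le_card_nsmul _ _ (C ^ p.toReal) fun i _ => ?_).trans_eq ?_
    · rw [norm_smul, Real.norm_eq_abs, hc, one_mul]
      exact Real.rpow_le_rpow (norm_nonneg _) (hyC i) h0.le
    · rw [Finset.card_range, nsmul_eq_mul, mul_comm]

/-- A bounded bilinear form cannot be bounded below on bounded pairs of bumps arbitrarily far out,
because disjoint bumps satisfy an upper `p`-estimate with `p > 2`. -/
theorem not_forall_exists_bumps (h2 : 2 < p.toReal)
    (B : JamesSpace (lpUnitBasis p) →L[ℝ] StrongDual ℝ (JamesSpace (lpUnitBasis p)))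
    (C : ℝ) {ε : ℝ} (hε : 0 < ε) :
    ¬ ∀ N : ℕ, ∃ (x y : JamesC00 (lpUnitBasis p)) (M : ℕ),
      (∀ n, jamesPartialSum _ n x ≠ 0 → N ≤ n ∧ n < M) ∧
      (∀ n, jamesPartialSum _ n y ≠ 0 → N ≤ n ∧ n < M) ∧
      ‖x‖ ≤ C ∧ ‖y‖ ≤ C ∧ ε ≤ |B (jamesEmb p x) (jamesEmb p y)| := by
  intro H
  have h0 : 0 < p.toReal := by linarith
  have H' : ∀ N : ℕ, ∃ (x y : JamesC00 (lpUnitBasis p)) (M : ℕ),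
      (∀ n, jamesPartialSum _ n x ≠ 0 → N ≤ n ∧ n < M) ∧
      (∀ n, jamesPartialSum _ n y ≠ 0 → N ≤ n ∧ n < M) ∧
      ‖x‖ ≤ C ∧ ‖y‖ ≤ C ∧ ε ≤ B (jamesEmb p x) (jamesEmb p y) := by
    intro N
    obtain ⟨x, y, M, hx, hy, hxC, hyC, hB⟩ := H N
    rcases le_abs.1 hB with h | h
    · exact ⟨x, y, M, hx, hy, hxC, hyC, h⟩
    · exact ⟨-x, y, M, by simpa using hx, hy, by rwa [norm_neg], hyC, by simpa using h⟩
  choose x y M hx hy hxC hyC hB using H'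
  have hC : 0 ≤ C := (norm_nonneg _).trans (hxC 0)
  -- Each new pair starts no earlier than the end of the previous one, which makes the chosen bumps
  -- disjoint.
  let f : ℕ → ℕ := fun i => Nat.rec 0 (fun _ n => max n (M n)) i
  have hf : ∀ i, f (i + 1) = max (f i) (M (f i)) := fun i => rfl
  have hmono : Monotone f := monotone_nat_of_le_succ fun i => by rw [hf]; exact le_max_left _ _
  have hdisj : ∀ z : ℕ → JamesC00 (lpUnitBasis p),
      (∀ N n, jamesPartialSum _ n (z N) ≠ 0 → N ≤ n ∧ n < M N) →
      ∀ n i j, jamesPartialSum _ n (z (f i)) ≠ 0 → jamesPartialSum _ n (z (f j)) ≠ 0 → i = j := by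
    intro z hz n
    have key : ∀ i j, i < j → jamesPartialSum _ n (z (f i)) ≠ 0 →
        jamesPartialSum _ n (z (f j)) ≠ 0 → False := by
      intro i j hij hi hj
      have h1 := (hz _ _ hi).2
      have h2 := (hz _ _ hj).1
      have h3 : f (i + 1) ≤ f j := hmono hij
      rw [hf] at h3
      have := le_max_right (f i) (M (f i))
      omega
    intro i j hi hj
    rcases lt_trichotomy i j with h | h | h
    · exact (key i j h hi hj).elim
    · exact h
    · exact (key j i h hj hi).elim
  have hbound : ∀ m : ℕ, 0 < m →
      (m : ℝ) ^ (1 - 2 * p.toReal⁻¹) ≤ ‖B‖ * (2 * C) * (2 * C) / ε := by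
    intro m hm
    obtain ⟨c, hc, hle⟩ := exists_signs_sum_le B (fun i => jamesEmb p (x (f i)))
      (fun i => jamesEmb p (y (f i))) m
    simp only [← map_smul, ← map_sum (jamesEmb p)] at hle
    have h1 : (m : ℝ) * ε ≤
        ∑ i ∈ Finset.range m, B (jamesEmb p (x (f i))) (jamesEmb p (y (f i))) := by
      simpa using Finset.card_nsmul_le_sum (Finset.range m) _ ε fun i _ => hB (f i)
    have hX := norm_sum_le_of_disjoint h0 hC m (fun i => hxC (f i)) (hdisj x hx) hc
    have hY := norm_sum_le_of_disjoint h0 hC m (fun i => hyC (f i)) (hdisj y hy) hc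
    have h3 := ((le_abs_self _).trans (B.le_opNorm₂ (jamesEmb p (∑ i ∈ Finset.range m, c i • x (f i)))
      (jamesEmb p (∑ i ∈ Finset.range m, c i • y (f i)))))
    rw [norm_jamesEmb, norm_jamesEmb] at h3
    have h4 : (m : ℝ) * ε ≤
        ‖B‖ * (2 * C * (m : ℝ) ^ p.toReal⁻¹) * (2 * C * (m : ℝ) ^ p.toReal⁻¹) := by
      refine (h1.trans (hle.trans h3)).trans ?_
      gcongr
    have hm' : (0 : ℝ) < m := by exact_mod_cast hm
    have h5 : (m : ℝ) =
        (m : ℝ) ^ (1 - 2 * p.toReal⁻¹) * ((m : ℝ) ^ p.toReal⁻¹ * (m : ℝ) ^ p.toReal⁻¹) := by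
      rw [← Real.rpow_add hm', ← Real.rpow_add hm']
      ring_nf
      simp
    have h6 : 0 < (m : ℝ) ^ p.toReal⁻¹ * (m : ℝ) ^ p.toReal⁻¹ := by positivity
    rw [le_div_iff₀ hε]
    refine le_of_mul_le_mul_right ?_ h6
    calc _ = (m : ℝ) ^ (1 - 2 * p.toReal⁻¹) *
          ((m : ℝ) ^ p.toReal⁻¹ * (m : ℝ) ^ p.toReal⁻¹) * ε := by ring
      _ = m * ε := by rw [← h5]
      _ ≤ _ := h4
      _ = _ := by ring
  have hexp : 0 < 1 - 2 * p.toReal⁻¹ := by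
    have : 2 * p.toReal⁻¹ < 1 := by
      rw [← div_eq_mul_inv, div_lt_one h0]
      exact h2
    linarith
  have hlim := (tendsto_rpow_atTop hexp).comp (tendsto_natCast_atTop_atTop (R := ℝ))
  obtain ⟨m, hm, hm0⟩ := ((hlim.eventually_gt_atTop (‖B‖ * (2 * C) * (2 * C) / ε)).and
    (eventually_gt_atTop 0)).exists
  exact (hbound m hm0).not_gt hm

/-- The linear version of `not_forall_exists_bumps`. -/
theorem exists_forall_bump_lt (h2 : 2 < p.toReal) (φ : StrongDual ℝ (JamesSpace (lpUnitBasis p)))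
    (C : ℝ) {ε : ℝ} (hε : 0 < ε) :
    ∃ N : ℕ, ∀ (x : JamesC00 (lpUnitBasis p)) (M : ℕ),
      (∀ n, jamesPartialSum _ n x ≠ 0 → N ≤ n ∧ n < M) → ‖x‖ ≤ C → |φ (jamesEmb p x)| < ε := by
  by_contra! H
  -- The form is φ ⊗ φ, evaluated at (x, x).
  refine not_forall_exists_bumps h2 (φ.smulRight φ) C (ε := ε * ε) (by positivity) fun N => ?_
  obtain ⟨x, M, hx, hxC, hφ⟩ := H N
  refine ⟨x, x, M, hx, hx, hxC, hxC, ?_⟩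
  simp only [ContinuousLinearMap.smulRight_apply, smul_apply, smul_eq_mul,
    abs_mul]
  exact mul_le_mul hφ hφ hε.le (abs_nonneg _)

end Bumps

/-! ### The dual and the bidual -/

section Functionals

variable {p : ℝ≥0∞} [Fact (1 ≤ p)]

theorem denseRange_jamesEmb : DenseRange (jamesEmb p) :=
  UniformSpace.Completion.denseRange_coe

theorem opNorm_le_of_jamesEmb (φ : StrongDual ℝ (JamesSpace (lpUnitBasis p))) {K : ℝ} (hK : 0 ≤ K)
    (h : ∀ a, |φ (jamesEmb p a)| ≤ K * ‖a‖) : ‖φ‖ ≤ K := by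
  refine φ.opNorm_le_bound hK (isClosed_property denseRange_jamesEmb
    (isClosed_le (by fun_prop) (by fun_prop)) fun a => ?_)
  rw [norm_jamesEmb]
  exact h a

/-- The linear functional `a ↦ ∑ a j` on `c₀₀`. -/
def jamesTotalSum (e : ℕ → lp (fun _ : ℕ => ℝ) p) : JamesC00 e →ₗ[ℝ] ℝ :=
  Finsupp.linearCombination ℝ (fun _ => (1 : ℝ)) ∘ₗ (JamesC00.toFinsupp e).toLinearMap

theorem jamesTotalSum_unit (n : ℕ) : jamesTotalSum _ (jamesUnit (lpUnitBasis p) n) = 1 := by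
  simp [jamesTotalSum, jamesUnit]

theorem exists_jamesPartialSum_eq_totalSum (a : JamesC00 (lpUnitBasis p)) :
    ∃ N, ∀ n, N ≤ n → jamesPartialSum _ n a = jamesTotalSum _ a := by
  obtain ⟨N, hN⟩ := jamesC00_eq_sum_unit _ a
  refine ⟨N, fun n hn => ?_⟩
  conv_rhs => rw [hN n hn]
  simp [jamesTotalSum_unit, jamesPartialSum_apply]

/-- The `n`-th partial sum functional on the James type space. -/
def jamesEval (p : ℝ≥0∞) [Fact (1 ≤ p)] (n : ℕ) : StrongDual ℝ (JamesSpace (lpUnitBasis p)) :=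
  (jamesPartialSum (lpUnitBasis p) n).extendOfNorm (jamesEmb p)

/-- The sum functional on the James type space. -/
def jamesSum (p : ℝ≥0∞) [Fact (1 ≤ p)] : StrongDual ℝ (JamesSpace (lpUnitBasis p)) :=
  (jamesTotalSum (lpUnitBasis p)).extendOfNorm (jamesEmb p)

theorem jamesEval_emb (h0 : 0 < p.toReal) (n : ℕ) (a : JamesC00 (lpUnitBasis p)) :
    jamesEval p n (jamesEmb p a) = jamesPartialSum _ n a :=
  LinearMap.extendOfNorm_eq denseRange_jamesEmb
    ⟨1, fun b => by simpa [norm_jamesEmb] using abs_jamesPartialSum_le h0 b n⟩ a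

theorem jamesSum_emb (h0 : 0 < p.toReal) (a : JamesC00 (lpUnitBasis p)) :
    jamesSum p (jamesEmb p a) = jamesTotalSum _ a := by
  refine LinearMap.extendOfNorm_eq denseRange_jamesEmb ⟨1, fun b => ?_⟩ a
  obtain ⟨N, hN⟩ := exists_jamesPartialSum_eq_totalSum b
  rw [← hN N le_rfl]
  simpa [norm_jamesEmb] using abs_jamesPartialSum_le h0 b N

theorem jamesEval_zero (h0 : 0 < p.toReal) : jamesEval p 0 = 0 := by
  refine norm_le_zero_iff.1 (opNorm_le_of_jamesEmb _ le_rfl fun a => ?_)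
  simp [jamesEval_emb h0]

theorem norm_jamesEval_sub_jamesSum_le (h0 : 0 < p.toReal) (n : ℕ) :
    ‖jamesEval p n - jamesSum p‖ ≤ 1 := by
  refine opNorm_le_of_jamesEmb _ zero_le_one fun a => ?_
  obtain ⟨N, hN⟩ := exists_jamesPartialSum_eq_totalSum a
  rw [sub_apply, jamesEval_emb h0, jamesSum_emb h0,
    ← hN (max n N) (le_max_right _ _), one_mul, abs_sub_comm]
  exact abs_jamesPartialSum_sub_le h0 a (le_max_left _ _)

theorem tendsto_jamesEval (h0 : 0 < p.toReal) (x : JamesSpace (lpUnitBasis p)) :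
    Tendsto (fun n => jamesEval p n x) atTop (𝓝 (jamesSum p x)) := by
  rw [Metric.tendsto_atTop]
  intro ε hε
  obtain ⟨a, ha⟩ := denseRange_jamesEmb.exists_dist_lt x hε
  obtain ⟨N, hN⟩ := exists_jamesPartialSum_eq_totalSum a
  refine ⟨N, fun n hn => ?_⟩
  have h1 : (jamesEval p n - jamesSum p) (jamesEmb p a) = 0 := by
    rw [sub_apply, jamesEval_emb h0, jamesSum_emb h0, hN n hn, sub_self]
  rw [dist_eq_norm, ← sub_apply]
  calc ‖(jamesEval p n - jamesSum p) x‖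
      = ‖(jamesEval p n - jamesSum p) (x - jamesEmb p a)‖ := by rw [map_sub _ x, h1, sub_zero]
    _ ≤ 1 * ‖x - jamesEmb p a‖ := ContinuousLinearMap.le_of_opNorm_le _
        (norm_jamesEval_sub_jamesSum_le h0 n) _
    _ < ε := by rwa [one_mul, ← dist_eq_norm]

theorem cauchySeq_dual_unit (h2 : 2 < p.toReal)
    (φ : StrongDual ℝ (JamesSpace (lpUnitBasis p))) :
    CauchySeq fun n => φ (jamesEmb p (jamesUnit _ n)) := by
  rw [Metric.cauchySeq_iff']
  intro ε hε
  obtain ⟨N, hN⟩ := exists_forall_bump_lt h2 φ 2 hε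
  refine ⟨N, fun n hn => ?_⟩
  rw [Real.dist_eq, ← map_sub, ← map_sub]
  refine hN _ (n + 1) (fun k hk => ?_) ?_
  · rw [map_sub, jamesPartialSum_unit, jamesPartialSum_unit] at hk
    by_contra h
    apply hk
    split_ifs <;> first | omega | simp
  · refine (norm_sub_le _ _).trans ?_
    have h0 : 0 < p.toReal := by linarith
    linarith [norm_jamesUnit_le h0 n, norm_jamesUnit_le h0 N]

theorem exists_bidual_tendsto_unit (h2 : 2 < p.toReal) :
    ∃ F : StrongDual ℝ (StrongDual ℝ (JamesSpace (lpUnitBasis p))),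
      ∀ φ, Tendsto (fun n => φ (jamesEmb p (jamesUnit _ n))) atTop (𝓝 (F φ)) := by
  choose f hf using fun φ => cauchySeq_tendsto_of_complete (cauchySeq_dual_unit h2 φ)
  refine ⟨continuousLinearMapOfTendsto (l := atTop) (fun n =>
    NormedSpace.inclusionInDoubleDual ℝ _ (jamesEmb p (jamesUnit _ n))) (f := f) ?_, hf⟩
  exact tendsto_pi_nhds.2 hf

/-- The truncation `∑_{j < N} a j u j`. -/
def jamesTrunc (N : ℕ) (a : JamesC00 (lpUnitBasis p)) : JamesC00 (lpUnitBasis p) :=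
  ∑ j ∈ Finset.range N, JamesC00.toFinsupp _ a j • jamesUnit _ j

theorem jamesPartialSum_trunc (N n : ℕ) (a : JamesC00 (lpUnitBasis p)) :
    jamesPartialSum _ n (jamesTrunc N a) = jamesPartialSum _ (min n N) a := by
  rw [jamesTrunc, jamesPartialSum_sum_smul_unit, jamesPartialSum_apply]

theorem norm_trunc_rpow_add_le (h0 : 0 < p.toReal) (N : ℕ) (a : JamesC00 (lpUnitBasis p)) :
    ‖jamesTrunc N a‖ ^ p.toReal + ‖a - jamesTrunc N a‖ ^ p.toReal ≤ ‖a‖ ^ p.toReal := by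
  refine norm_rpow_add_norm_rpow_le h0 N (fun n => jamesPartialSum_trunc N n a) fun n => ?_
  rw [map_sub, jamesPartialSum_trunc]
  rcases le_total n N with h | h <;> simp [h]

theorem norm_trunc_le (h0 : 0 < p.toReal) (N : ℕ) (a : JamesC00 (lpUnitBasis p)) :
    ‖jamesTrunc N a‖ ≤ ‖a‖ := by
  rw [← Real.rpow_le_rpow_iff (norm_nonneg _) (norm_nonneg _) h0]
  exact (le_add_of_nonneg_right (by positivity)).trans (norm_trunc_rpow_add_le h0 N a)

theorem norm_sub_trunc_le (h0 : 0 < p.toReal) (N : ℕ) (a : JamesC00 (lpUnitBasis p)) :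
    ‖a - jamesTrunc N a‖ ≤ ‖a‖ := by
  rw [← Real.rpow_le_rpow_iff (norm_nonneg _) (norm_nonneg _) h0]
  exact (le_add_of_nonneg_left (by positivity)).trans (norm_trunc_rpow_add_le h0 N a)

/-- The functional `φ ∘ P N`, where `P N` is the truncation. -/
def jamesDualTrunc (N : ℕ) (φ : StrongDual ℝ (JamesSpace (lpUnitBasis p))) :
    StrongDual ℝ (JamesSpace (lpUnitBasis p)) :=
  ∑ j ∈ Finset.range N, φ (jamesEmb p (jamesUnit _ j)) • (jamesEval p (j + 1) - jamesEval p j)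

theorem jamesDualTrunc_emb (h0 : 0 < p.toReal) (N : ℕ)
    (φ : StrongDual ℝ (JamesSpace (lpUnitBasis p))) (a : JamesC00 (lpUnitBasis p)) :
    jamesDualTrunc N φ (jamesEmb p a) = φ (jamesEmb p (jamesTrunc N a)) := by
  simp only [jamesDualTrunc, jamesTrunc, map_sum, map_smul, sum_apply,
    smul_apply, sub_apply, jamesEval_emb h0]
  refine Finset.sum_congr rfl fun j _ => ?_
  rw [← sum_Ico_toFinsupp _ _ (Nat.le_succ j)]
  simp [mul_comm]

theorem norm_jamesDualTrunc_le (h0 : 0 < p.toReal) (N : ℕ)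
    (φ : StrongDual ℝ (JamesSpace (lpUnitBasis p))) : ‖jamesDualTrunc N φ‖ ≤ ‖φ‖ := by
  refine opNorm_le_of_jamesEmb _ (norm_nonneg _) fun a => ?_
  rw [jamesDualTrunc_emb h0]
  refine (φ.le_opNorm _).trans (mul_le_mul_of_nonneg_left ?_ (norm_nonneg _))
  rw [norm_jamesEmb]
  exact norm_trunc_le h0 N a

/-- The values of G on the partial sum functionals prescribe a formal series. Its partial sums X N
are bounded by ‖G‖, and the lower p-estimate turns boundedness into convergence. -/
theorem exists_jamesEval_eq_bidual (h0 : 0 < p.toReal)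
    (G : StrongDual ℝ (StrongDual ℝ (JamesSpace (lpUnitBasis p)))) :
    ∃ x, ∀ n, jamesEval p n x = G (jamesEval p n) := by
  let X : ℕ → JamesC00 (lpUnitBasis p) := fun N =>
    ∑ j ∈ Finset.range N, (G (jamesEval p (j + 1)) - G (jamesEval p j)) • jamesUnit _ j
  have hXG : ∀ N, ‖X N‖ ≤ ‖G‖ := fun N => by
    rw [← norm_jamesEmb]
    refine NormedSpace.norm_le_dual_bound ℝ _ (ContinuousLinearMap.opNorm_nonneg G) fun φ => ?_
    -- X N is the truncation of G: pairing it with φ is applying G to the truncated φ, whose norm is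
    -- at most ‖φ‖.
    have : φ (jamesEmb p (X N)) = G (jamesDualTrunc N φ) := by
      simp only [X, jamesDualTrunc, map_sum, map_smul, map_sub, smul_eq_mul]
      exact Finset.sum_congr rfl fun j _ => mul_comm _ _
    rw [this]
    exact (G.le_opNorm _).trans
      (mul_le_mul_of_nonneg_left (norm_jamesDualTrunc_le h0 N φ) (norm_nonneg _))
  have hps : ∀ N n, jamesPartialSum _ n (X N) = G (jamesEval p (min n N)) := fun N n => by
    rw [jamesPartialSum_sum_smul_unit, Finset.sum_range_sub fun j => G (jamesEval p j),
      jamesEval_zero h0, map_zero, sub_zero]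
  have hsuper : ∀ N M, N ≤ M →
      ‖X N‖ ^ p.toReal + ‖X M - X N‖ ^ p.toReal ≤ ‖X M‖ ^ p.toReal := fun N M h => by
    refine norm_rpow_add_norm_rpow_le h0 N (fun n => ?_) fun n => ?_
    · rw [hps, hps, min_assoc, min_eq_left h]
    · rw [map_sub, hps, hps, hps, hps, min_eq_left h]
      rcases le_total n N with hn | hn
      · simp [hn, h, hn.trans h]
      · simp [hn]
  have hmono : Monotone fun N => ‖X N‖ ^ p.toReal := fun N M h =>
    (le_add_of_nonneg_right (by positivity)).trans (hsuper N M h)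
  have hlim := tendsto_atTop_ciSup hmono ⟨‖G‖ ^ p.toReal, by
    rintro _ ⟨N, rfl⟩
    exact Real.rpow_le_rpow (norm_nonneg _) (hXG N) h0.le⟩
  have hcauchy : CauchySeq fun N => jamesEmb p (X N) := by
    rw [Metric.cauchySeq_iff']
    intro ε hε
    obtain ⟨N, hN⟩ := Metric.cauchySeq_iff'.1 hlim.cauchySeq (ε ^ p.toReal) (by positivity)
    refine ⟨N, fun M hM => ?_⟩
    rw [dist_eq_norm, ← map_sub, norm_jamesEmb, ← Real.rpow_lt_rpow_iff (norm_nonneg _) hε.le h0]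
    have h1 := (le_abs_self _).trans_lt (hN M hM)
    linarith [hsuper N M hM]
  obtain ⟨x, hx⟩ := cauchySeq_tendsto_of_complete hcauchy
  refine ⟨x, fun n => tendsto_nhds_unique (((jamesEval p n).continuous.tendsto x).comp hx) ?_⟩
  refine tendsto_const_nhds.congr' ?_
  filter_upwards [eventually_ge_atTop n] with N hN
  rw [Function.comp_apply, jamesEval_emb h0, hps, min_eq_left hN]

/-- A tail of b is a bump plus a multiple of one far unit vector; φ is small on both, hence φ lies
in the norm closure of the span of the partial sum functionals. -/
theorem exists_dual_sub_trunc_le (h2 : 2 < p.toReal)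
    {φ : StrongDual ℝ (JamesSpace (lpUnitBasis p))}
    (hφ : Tendsto (fun n => φ (jamesEmb p (jamesUnit _ n))) atTop (𝓝 0)) {ε : ℝ} (hε : 0 < ε) :
    ∃ N, ‖φ - jamesDualTrunc N φ‖ ≤ ε := by
  have h0 : 0 < p.toReal := by linarith
  obtain ⟨N₁, hN₁⟩ := exists_forall_bump_lt h2 φ 2 (half_pos hε)
  obtain ⟨N₂, hN₂⟩ := Metric.tendsto_atTop.1 hφ (ε / 2) (half_pos hε)
  set N := max N₁ N₂
  refine ⟨N, opNorm_le_of_jamesEmb _ hε.le fun a => ?_⟩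
  rw [sub_apply, jamesDualTrunc_emb h0, ← map_sub, ← map_sub]
  have key : ∀ b : JamesC00 (lpUnitBasis p), ‖b‖ ≤ 1 →
      |φ (jamesEmb p (b - jamesTrunc N b))| ≤ ε := by
    intro b hb
    obtain ⟨M, hM⟩ := exists_jamesPartialSum_eq_totalSum b
    set K := max N M
    -- Beyond K the partial sums of the tail are constantly c; subtracting c times the K-th unit
    -- vector makes them vanish there.
    set c := jamesPartialSum _ K (b - jamesTrunc N b) with hc
    have hnorm : ‖b - jamesTrunc N b‖ ≤ 1 := (norm_sub_trunc_le h0 N b).trans hb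
    have hc1 : |c| ≤ 1 := (abs_jamesPartialSum_le h0 _ K).trans hnorm
    have h1 : |φ (jamesEmb p (b - jamesTrunc N b - c • jamesUnit _ K))| < ε / 2 := by
      refine hN₁ _ (K + 1) (fun n hn => ?_) ?_
      · by_contra hcon
        apply hn
        simp only [map_sub, map_smul, jamesPartialSum_unit, jamesPartialSum_trunc, hc, smul_eq_mul]
        rcases le_or_gt n N with hnN | hnN
        · rw [min_eq_left hnN, if_neg (by omega)]
          simp
        · rw [if_pos (by omega), min_eq_right hnN.le, hM n (by omega), hM K (by omega),
            min_eq_right (le_max_left N M)]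
          simp
      · refine (norm_sub_le _ _).trans ?_
        rw [norm_smul, Real.norm_eq_abs]
        have := mul_le_mul hc1 (norm_jamesUnit_le h0 K) (norm_nonneg _) zero_le_one
        linarith
    have h3 : |φ (jamesEmb p (jamesUnit _ K))| < ε / 2 := by
      simpa using hN₂ K (by omega)
    have h4 : φ (jamesEmb p (b - jamesTrunc N b)) =
        φ (jamesEmb p (b - jamesTrunc N b - c • jamesUnit _ K)) +
          c * φ (jamesEmb p (jamesUnit _ K)) := by
      simp
    rw [h4]
    refine (abs_add_le _ _).trans ?_
    rw [abs_mul]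
    have := mul_le_mul hc1 h3.le (abs_nonneg _) zero_le_one
    linarith
  -- c₀₀ carries only a seminormed structure here, so norm 0 is treated apart from the rescaling.
  rcases (norm_nonneg a).eq_or_lt with ha | ha
  · rw [← ha, mul_zero]
    refine (φ.le_opNorm _).trans ?_
    rw [norm_jamesEmb]
    exact mul_nonpos_of_nonneg_of_nonpos (norm_nonneg _) ((norm_sub_trunc_le h0 N a).trans ha.ge)
  · have h5 := key (‖a‖⁻¹ • a) (by rw [norm_smul, norm_inv, norm_norm, inv_mul_cancel₀ ha.ne'])
    have h6 : ‖a‖⁻¹ • a - jamesTrunc N (‖a‖⁻¹ • a) = ‖a‖⁻¹ • (a - jamesTrunc N a) := by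
      rw [smul_sub, jamesTrunc, jamesTrunc, Finset.smul_sum]
      simp [mul_smul]
    rw [h6, map_smul, map_smul, smul_eq_mul, abs_mul, abs_of_pos (inv_pos.2 ha),
      inv_mul_le_iff₀ ha] at h5
    linarith

theorem bidual_eq_zero_of_tendsto (h2 : 2 < p.toReal)
    {G : StrongDual ℝ (StrongDual ℝ (JamesSpace (lpUnitBasis p)))}
    (hG : ∀ n, G (jamesEval p n) = 0) {φ : StrongDual ℝ (JamesSpace (lpUnitBasis p))}
    (hφ : Tendsto (fun n => φ (jamesEmb p (jamesUnit _ n))) atTop (𝓝 0)) : G φ = 0 := by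
  refine norm_le_zero_iff.1 (le_of_forall_pos_le_add fun ε hε => ?_)
  obtain ⟨N, hN⟩ := exists_dual_sub_trunc_le h2 hφ (ε := ε / (‖G‖ + 1)) (by positivity)
  have h1 : G (jamesDualTrunc N φ) = 0 := by simp [jamesDualTrunc, hG]
  have h3 : G φ = G (φ - jamesDualTrunc N φ) := by rw [map_sub, h1, sub_zero]
  rw [h3, zero_add]
  refine (G.le_opNorm _).trans ((mul_le_mul (lt_add_one ‖G‖).le hN (norm_nonneg _)
    (by positivity)).trans_eq ?_)
  field_simp

theorem jamesSum_unit (h0 : 0 < p.toReal) (n : ℕ) :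
    jamesSum p (jamesEmb p (jamesUnit _ n)) = 1 := by
  rw [jamesSum_emb h0, jamesTotalSum_unit]

theorem bidual_jamesSum (h0 : 0 < p.toReal)
    {F : StrongDual ℝ (StrongDual ℝ (JamesSpace (lpUnitBasis p)))}
    (hF : ∀ φ, Tendsto (fun n => φ (jamesEmb p (jamesUnit _ n))) atTop (𝓝 (F φ))) :
    F (jamesSum p) = 1 :=
  tendsto_nhds_unique (hF _) (by simp only [jamesSum_unit h0]; exact tendsto_const_nhds)

theorem bidual_jamesEval (h0 : 0 < p.toReal)
    {F : StrongDual ℝ (StrongDual ℝ (JamesSpace (lpUnitBasis p)))}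
    (hF : ∀ φ, Tendsto (fun n => φ (jamesEmb p (jamesUnit _ n))) atTop (𝓝 (F φ))) (n : ℕ) :
    F (jamesEval p n) = 0 := by
  refine tendsto_nhds_unique (hF _) (tendsto_const_nhds.congr' ?_)
  filter_upwards [eventually_ge_atTop n] with m hm
  rw [jamesEval_emb h0, jamesPartialSum_unit, if_neg (by omega)]

/-- The James type space has codimension one in its bidual. -/
theorem exists_bidual_eq (h2 : 2 < p.toReal)
    {F : StrongDual ℝ (StrongDual ℝ (JamesSpace (lpUnitBasis p)))}
    (hF : ∀ φ, Tendsto (fun n => φ (jamesEmb p (jamesUnit _ n))) atTop (𝓝 (F φ)))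
    (G : StrongDual ℝ (StrongDual ℝ (JamesSpace (lpUnitBasis p)))) :
    ∃ (x : JamesSpace (lpUnitBasis p)) (c : ℝ), ∀ φ, G φ = φ x + c * F φ := by
  have h0 : 0 < p.toReal := by linarith
  obtain ⟨x, hx⟩ := exists_jamesEval_eq_bidual h0 G
  -- x matches G on partial sums, and c corrects the value at the total sum, where F is 1.
  -- Subtracting F φ times the total sum from φ leaves a functional tending to 0 on the unit
  -- vectors.
  set c := G (jamesSum p) - jamesSum p x with hc
  have hFS := bidual_jamesSum h0 hF
  have hFδ := bidual_jamesEval h0 hF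
  have hunit := fun n => jamesSum_unit (p := p) h0 n
  refine ⟨x, c, fun φ => ?_⟩
  have h1 := bidual_eq_zero_of_tendsto h2
    (G := G - NormedSpace.inclusionInDoubleDual ℝ _ x - c • F) (fun n => by simp [hx, hFδ])
    (φ := φ - F φ • jamesSum p) (by simpa [hunit] using (hF φ).sub_const (F φ))
  simp only [sub_apply, smul_apply, NormedSpace.dual_def, map_sub, map_smul, smul_eq_mul, hFS,
    hc] at h1 ⊢
  linarith

end Functionals

/-- An operator whose second adjoint maps the bidual into the (canonically embedded) range space is
weakly compact. -/
theorem isWeaklyCompactOperator_of_bidual {E F : Type*} [NormedAddCommGroup E] [NormedSpace ℝ E]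
    [NormedAddCommGroup F] [NormedSpace ℝ F] (T : E →L[ℝ] F)
    (h : ∀ G : StrongDual ℝ (StrongDual ℝ E), ∃ y : F, ∀ H : StrongDual ℝ F, G (H.comp T) = H y) :
    IsWeaklyCompactOperator T := by
  choose g hg using h
  let f : WeakDual ℝ (StrongDual ℝ E) → WeakSpace ℝ F :=
    fun G => toWeakSpace ℝ F (g (WeakDual.toStrongDual G))
  -- The second adjoint is weak*-to-weak continuous, so the image of the weak* compact bidual ball
  -- (Banach–Alaoglu) is weakly compact and contains the image of the unit ball.
  have hf : Continuous f := by
    refine WeakBilin.continuous_of_continuous_eval _ fun H => ?_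
    exact (WeakDual.eval_continuous (H.comp T)).congr fun G => hg _ H
  have hK := (WeakDual.isCompact_closedBall (0 : StrongDual ℝ (StrongDual ℝ E)) 1).image hf
  refine hK.closure_of_subset ?_
  rintro _ ⟨_, ⟨x, hx, rfl⟩, rfl⟩
  refine ⟨StrongDual.toWeakDual (NormedSpace.inclusionInDoubleDual ℝ E x), ?_, ?_⟩
  · simp only [Set.mem_preimage, Metric.mem_closedBall, dist_zero_right] at hx ⊢
    exact (NormedSpace.double_dual_bound ℝ E x).trans hx
  · refine congrArg (toWeakSpace ℝ F) (SeparatingDual.eq_iff_forall_dual_eq (R := ℝ).2 fun H => ?_)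
    exact (hg (NormedSpace.inclusionInDoubleDual ℝ E x) H).symm

/-! ### Iterated limits and the two conclusions -/

section Main

variable {p : ℝ≥0∞} [Fact (1 ≤ p)]

/-- The iterated limits of a bounded bilinear form along the unit vectors agree. -/
theorem iterated_limits_eq (h2 : 2 < p.toReal)
    (B : JamesSpace (lpUnitBasis p) →L[ℝ] StrongDual ℝ (JamesSpace (lpUnitBasis p)))
    {f g : ℕ → ℝ} {α β : ℝ}
    (hf : ∀ a, Tendsto (fun b => B (jamesEmb p (jamesUnit _ a)) (jamesEmb p (jamesUnit _ b)))
      atTop (𝓝 (f a)))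
    (hg : ∀ b, Tendsto (fun a => B (jamesEmb p (jamesUnit _ a)) (jamesEmb p (jamesUnit _ b)))
      atTop (𝓝 (g b)))
    (hα : Tendsto f atTop (𝓝 α)) (hβ : Tendsto g atTop (𝓝 β)) : α = β := by
  have h0 : 0 < p.toReal := by linarith
  rw [← sub_eq_zero, ← abs_nonpos_iff]
  refine le_of_forall_pos_le_add fun ε hε => ?_
  rw [zero_add]
  have hN := not_forall_exists_bumps h2 B 2 hε
  push Not at hN
  obtain ⟨N, hN⟩ := hN
  set A : ℕ → ℕ → ℝ := fun a b => B (jamesEmb p (jamesUnit _ a)) (jamesEmb p (jamesUnit _ b))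
    with hA
  have hsupp : ∀ a a' M, N ≤ a → N ≤ a' → a < M → a' < M → ∀ n, jamesPartialSum _ n
      (jamesUnit (lpUnitBasis p) a - jamesUnit _ a') ≠ 0 → N ≤ n ∧ n < M + 1 := by
    intro a a' M ha ha' haM haM' n hn
    rw [map_sub, jamesPartialSum_unit, jamesPartialSum_unit] at hn
    by_contra h
    apply hn
    split_ifs <;> first | omega | simp
  have hnorm : ∀ a a', ‖jamesUnit (lpUnitBasis p) a - jamesUnit _ a'‖ ≤ 2 := fun a a' =>
    (norm_sub_le _ _).trans (by linarith [norm_jamesUnit_le h0 a, norm_jamesUnit_le h0 a'])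
  -- The second difference is the form at a pair of bumps beyond N. Then b', a' and b go to infinity
  -- in this order, leaving |β - α| ≤ ε.
  have h1 : ∀ b, N ≤ b → ∀ a', N ≤ a' → ∀ b', N ≤ b' →
      |A N b - A N b' - (A a' b - A a' b')| ≤ ε := by
    intro b hb a' ha' b' hb'
    have := hN (jamesUnit _ N - jamesUnit _ a') (jamesUnit _ b - jamesUnit _ b')
      (N + b + a' + b' + 1 + 1)
      (hsupp N a' _ le_rfl ha' (by omega) (by omega)) (hsupp b b' _ hb hb' (by omega) (by omega))
      (hnorm _ _) (hnorm _ _)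
    refine (le_of_eq ?_).trans this.le
    simp only [hA, map_sub, sub_apply]
    congr 1
    ring
  have h3 : ∀ b, N ≤ b → ∀ a', N ≤ a' → |A N b - f N - (A a' b - f a')| ≤ ε := by
    intro b hb a' ha'
    refine le_of_tendsto (((hf N).const_sub (A N b)).sub ((hf a').const_sub (A a' b))).abs ?_
    filter_upwards [eventually_ge_atTop N] with b' hb' using h1 b hb a' ha' b' hb'
  have h4 : ∀ b, N ≤ b → |A N b - f N - (g b - α)| ≤ ε := by
    intro b hb
    refine le_of_tendsto (((hg b).sub hα).const_sub (A N b - f N)).abs ?_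
    filter_upwards [eventually_ge_atTop N] with a' ha' using h3 b hb a' ha'
  have h5 : |f N - f N - (β - α)| ≤ ε := by
    refine le_of_tendsto (((hf N).sub_const (f N)).sub (hβ.sub_const α)).abs ?_
    filter_upwards [eventually_ge_atTop N] with b hb using h4 b hb
  simpa using h5

theorem hasPropertyW_jamesSpace (h2 : 2 < p.toReal) : HasPropertyW (JamesSpace (lpUnitBasis p)) := by
  intro T
  obtain ⟨F, hF⟩ := exists_bidual_tendsto_unit h2 (p := p)
  have hFF : F (F.comp T) = F (F.comp T.flip) := by
    refine iterated_limits_eq h2 T (f := fun a => F (T (jamesEmb p (jamesUnit _ a))))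
      (g := fun b => F (T.flip (jamesEmb p (jamesUnit _ b)))) (fun a => hF _) (fun b => hF _)
      (hF (F.comp T)) (hF (F.comp T.flip))
  refine isWeaklyCompactOperator_of_bidual T fun G => ?_
  obtain ⟨x, c, hG⟩ := exists_bidual_eq h2 hF G
  -- Splitting both G and H along the bidual decomposition, all terms match except the F–F term,
  -- which is `hFF`.
  refine ⟨T x + c • F.comp T.flip, fun H => ?_⟩
  obtain ⟨y, d, hH⟩ := exists_bidual_eq h2 hF H
  have h1 : H.comp T = T.flip y + d • F.comp T := by
    ext z
    simp [hH]
  simp only [hG, hH, h1, map_add, map_smul, add_apply, smul_apply, smul_eq_mul,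
    ContinuousLinearMap.comp_apply, ContinuousLinearMap.flip_apply, hFF]
  ring

theorem not_isWeaklySequentiallyComplete_dual_jamesSpace (h2 : 2 < p.toReal) :
    ¬ IsWeaklySequentiallyComplete (StrongDual ℝ (JamesSpace (lpUnitBasis p))) := by
  intro h
  have h0 : 0 < p.toReal := by linarith
  obtain ⟨F, hF⟩ := exists_bidual_tendsto_unit h2 (p := p)
  -- On partial sum functionals every G acts as a point x, where they converge.
  obtain ⟨φ, hφ⟩ := h (jamesEval p) fun G => by
    obtain ⟨x, hx⟩ := exists_jamesEval_eq_bidual h0 G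
    simp only [← hx]
    exact (tendsto_jamesEval h0 x).cauchySeq
  have hS : φ = jamesSum p := by
    ext x
    exact tendsto_nhds_unique (hφ (NormedSpace.inclusionInDoubleDual ℝ _ x))
      (tendsto_jamesEval h0 x)
  have h1 : F φ = 0 := by
    refine tendsto_nhds_unique (hφ F) ?_
    simp only [bidual_jamesEval h0 hF]
    exact tendsto_const_nhds
  rw [hS, bidual_jamesSum h0 hF] at h1
  exact one_ne_zero h1

end Main

end

theorem mainTheorem2 :
    (∀ (p : ℝ≥0∞) [Fact (1 ≤ p)], 2 < p → p < ∞ →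
      HasPropertyW (JamesSpace (lpUnitBasis p)) ∧
        ¬ IsWeaklySequentiallyComplete (StrongDual ℝ (JamesSpace (lpUnitBasis p)))) ∧
    ¬ ∀ (X : Type) [NormedAddCommGroup X] [NormedSpace ℝ X] [CompleteSpace X],
      HasPropertyW X → IsWeaklySequentiallyComplete (StrongDual ℝ X) := by
  have main : ∀ (p : ℝ≥0∞) [Fact (1 ≤ p)], 2 < p → p < ∞ →
      HasPropertyW (JamesSpace (lpUnitBasis p)) ∧
        ¬ IsWeaklySequentiallyComplete (StrongDual ℝ (JamesSpace (lpUnitBasis p))) := by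
    intro p _ hp hp'
    -- Finiteness of p matters: `toReal` sends ∞ to 0.
    have h2 : 2 < p.toReal := by
      simpa using (ENNReal.toReal_lt_toReal (by simp) hp'.ne).2 hp
    exact ⟨hasPropertyW_jamesSpace h2, not_isWeaklySequentiallyComplete_dual_jamesSpace h2⟩
  refine ⟨main, fun h => ?_⟩
  have : Fact ((1 : ℝ≥0∞) ≤ 3) := ⟨by norm_num⟩
  obtain ⟨hw, hn⟩ := main 3 (by norm_num) (by simp)
  exact hn (h _ hw)
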